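/- For $n\in\{0,1\}$ let $I_n(x)=\sum_{k\ge 0}\frac{(x/2)^{2k+n}}{k!\,(k+n)!}$ be the modified Bessel functions of the first kind, and let $R(z)=I_1(z)/I_0(z)$. For $\gamma>0$ (the interferential SNR) define $$g(\gamma)=\int_0^{\infty}\gamma t\,e^{-\gamma(1+t)}\,I_0(2\gamma\sqrt t)\,\bigl(1-R^2(2\gamma\sqrt t)\bigr)\,dt,$$ $$\hat g(\gamma)=\frac14\sqrt{\frac{\pi}{\gamma}}\,e^{-\gamma/2}\Bigl(\bigl(1+\tfrac1\gamma\bigr)I_0(\gamma/2)+I_1(\gamma/2)\Bigr).$$ Let $r(\gamma)=\dfrac{|\hat g(\gamma)-g(\gamma)|}{1/\gamma-g(\gamma)}$ be the relative error of $1/\gamma-\hat g(\gamma)$ as an approximation of $1/\gamma-g(\gamma)$. Then $r(\gamma)=\mathcal O(1/\gamma)$ as $\gamma\to\infty$. Explicitly, for every $\gamma>0.42$ the integral defining $g(\gamma)$ converges absolutely, $1/\gamma-g(\gamma)>0$, and $$r(\gamma)\le\frac{0.07}{\gamma/6-0.07}.$$ -/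

import Mathlib

open Filter MeasureTheory Asymptotics

namespace SensingRIS

noncomputable section

/-- The modified Bessel function of the first kind of order `n`,
`I_n(x) = ∑_{k ≥ 0} (x/2)^(2k+n) / (k! (k+n)!)`. -/
def besselI (n : ℕ) (x : ℝ) : ℝ :=
  ∑' k : ℕ, (x / 2) ^ (2 * k + n) / ((k.factorial : ℝ) * ((k + n).factorial : ℝ))

/-- The series defining `besselI n x` converges for every real `x`. -/
theorem summable_besselI (n : ℕ) (x : ℝ) :
    Summable fun k : ℕ =>
      (x / 2) ^ (2 * k + n) / ((k.factorial : ℝ) * ((k + n).factorial : ℝ)) := by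
  have h := (Real.summable_pow_div_factorial ((x / 2) ^ 2)).abs.mul_left (|x / 2| ^ n)
  refine Summable.of_norm_bounded h fun k => ?_
  have h1 : (1 : ℝ) ≤ ((k + n).factorial : ℝ) := by
    exact_mod_cast Nat.succ_le_of_lt (Nat.factorial_pos _)
  have h2 : (0 : ℝ) < (k.factorial : ℝ) := by exact_mod_cast Nat.factorial_pos k
  have h3 : |(x / 2) ^ (2 * k + n)| = |x / 2| ^ n * |((x / 2) ^ 2) ^ k| := by
    rw [pow_add, abs_mul, pow_mul, abs_pow (x / 2) n, mul_comm]
  have h4 : |((x / 2) ^ 2) ^ k / (k.factorial : ℝ)| =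
      |((x / 2) ^ 2) ^ k| / (k.factorial : ℝ) := by rw [abs_div, abs_of_pos h2]
  rw [Real.norm_eq_abs, abs_div, h3, h4, ← mul_div_assoc,
    abs_of_pos (by positivity : (0 : ℝ) < (k.factorial : ℝ) * ((k + n).factorial : ℝ))]
  exact div_le_div_of_nonneg_left (by positivity) h2 (le_mul_of_one_le_right h2.le h1)

/-- The Bessel ratio `R(z) = I_1(z) / I_0(z)`. -/
def besselRatio (z : ℝ) : ℝ := besselI 1 z / besselI 0 z

/-- The integrand `γ t exp(-γ (1 + t)) I_0(2 γ √t) (1 - R²(2 γ √t))` of `g(γ)`. -/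
def gIntegrand (γ t : ℝ) : ℝ :=
  γ * t * Real.exp (-γ * (1 + t)) * besselI 0 (2 * γ * √t) *
    (1 - besselRatio (2 * γ * √t) ^ 2)

/-- The exact function `g(γ) = ∫_0^∞ γ t exp(-γ (1 + t)) I_0(2 γ √t) (1 - R²(2 γ √t)) dt`. -/
def g (γ : ℝ) : ℝ := ∫ t in Set.Ioi (0 : ℝ), gIntegrand γ t

/-- The approximation
`ĝ(γ) = (1/4) √(π/γ) exp(-γ/2) ((1 + 1/γ) I_0(γ/2) + I_1(γ/2))`. -/
def gHat (γ : ℝ) : ℝ :=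
  1 / 4 * √(Real.pi / γ) * Real.exp (-γ / 2) *
    ((1 + 1 / γ) * besselI 0 (γ / 2) + besselI 1 (γ / 2))

/-- The relative error of `1/γ - ĝ(γ)` as an approximation of `1/γ - g(γ)`. -/
def relError (γ : ℝ) : ℝ := |gHat γ - g γ| / (1 / γ - g γ)

end

end SensingRIS

namespace SensingRIS

noncomputable section

/-! Everything is integrated against the Rician weight w(t) = exp(-γ(1+t)) I_0(2γ√t). Its moments of
order 0, 1/2 and 1 are 1/γ, 2ĝ(γ) and (1+γ)/γ²; the middle one is Kummer's formula. With x = 2γ√t,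
the integrands of g and ĝ are w/(4γ) times x²(1-R(x)²) and x respectively. So a uniform bound |x -
x²(1-R(x)²)| ≤ 7/25 (`abs_sub_sq_mul_besselRatio_le`) integrates to |ĝ-g| ≤ 0.07/γ²
(`abs_gHat_sub_g_le`).

For the denominator, γĝ(γ) ≤ 5/6 (`mul_gHat_le`) gives 1/γ - g ≥ (γ/6 - 0.07)/γ², which is positive
exactly when γ > 0.42. Dividing the two estimates yields the stated bound.

The uniform bound rests on inequalities between I_0 and I_1, obtained from the system I_0' = I_1,
I_1' = I_0 - I_1/x. For f = a I_0 - b I_1 with a - b bounded, f' nearly exchanges the two functions,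
so the growing coefficients cancel in f' + f; hence the integrating factor exp(x). -/

theorem _root_.HasSum.congr_of_eq {f h : ℕ → ℝ} {a b : ℝ} (hf : HasSum f a)
    (hfh : ∀ k, f k = h k) (hab : a = b) : HasSum h b := by
  rwa [← hab, ← funext hfh]

theorem hasDerivAt_half_sq (x : ℝ) : HasDerivAt (fun x : ℝ => (x / 2) ^ 2) (x / 2) x :=
  (((hasDerivAt_id' x).div_const 2).pow 2).congr_deriv (by norm_num; ring)

/-! ### Series, derivatives and signs of I_0 and I_1 -/

/-- The entire function `y ↦ ∑ y^k / (k! (k+n)!)`, so that `I_n(x) = (x/2)^n φ_n((x/2)²)`. -/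
def besselPhi (n : ℕ) (y : ℝ) : ℝ :=
  ∑' k : ℕ, y ^ k / ((k.factorial : ℝ) * ((k + n).factorial : ℝ))

theorem summable_besselPhi (n : ℕ) (y : ℝ) :
    Summable fun k : ℕ => y ^ k / ((k.factorial : ℝ) * ((k + n).factorial : ℝ)) := by
  refine Summable.of_norm_bounded (Real.summable_pow_div_factorial y).abs fun k => ?_
  have h1 : (1 : ℝ) ≤ ((k + n).factorial : ℝ) := by
    exact_mod_cast Nat.succ_le_of_lt (Nat.factorial_pos _)
  have h2 : (0 : ℝ) < (k.factorial : ℝ) := by exact_mod_cast Nat.factorial_pos k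
  rw [Real.norm_eq_abs, abs_div, abs_div, abs_mul, abs_of_pos h2,
    abs_of_pos (by positivity : (0 : ℝ) < ((k + n).factorial : ℝ))]
  exact div_le_div_of_nonneg_left (by positivity) h2 (le_mul_of_one_le_right h2.le h1)

theorem besselI_eq_besselPhi (n : ℕ) (x : ℝ) :
    besselI n x = (x / 2) ^ n * besselPhi n ((x / 2) ^ 2) := by
  unfold besselI besselPhi
  rw [← tsum_mul_left]
  refine tsum_congr fun k => ?_
  rw [pow_add, pow_mul]
  ring

theorem hasDerivAt_besselPhi (n : ℕ) (y : ℝ) :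
    HasDerivAt (besselPhi n) (besselPhi (n + 1) y) y := by
  have key : ∀ (k : ℕ) (z : ℝ), ((k + 1 : ℕ) : ℝ) * z ^ k /
      (((k + 1).factorial : ℝ) * ((k + 1 + n).factorial : ℝ)) =
      z ^ k / ((k.factorial : ℝ) * ((k + (n + 1)).factorial : ℝ)) := by
    intro k z
    rw [show k + 1 + n = k + (n + 1) by ring, Nat.factorial_succ k]
    have := Nat.factorial_ne_zero k
    have := Nat.factorial_ne_zero (k + (n + 1))
    push_cast
    field_simp
  have hs : ∀ z : ℝ, Summable fun k : ℕ => (k : ℝ) * z ^ (k - 1) /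
      ((k.factorial : ℝ) * ((k + n).factorial : ℝ)) := by
    intro z
    rw [← summable_nat_add_iff 1]
    refine (summable_besselPhi (n + 1) z).congr fun k => ?_
    simpa using (key k z).symm
  have h := hasDerivAt_tsum_of_isPreconnected
    (g := fun (k : ℕ) (z : ℝ) => z ^ k / ((k.factorial : ℝ) * ((k + n).factorial : ℝ)))
    (g' := fun (k : ℕ) (z : ℝ) => (k : ℝ) * z ^ (k - 1) /
      ((k.factorial : ℝ) * ((k + n).factorial : ℝ)))
    -- On this ball the differentiated terms are dominated by their values at |y| + 1.
    (t := Metric.ball 0 (|y| + 1)) (y₀ := y) (y := y) (hs (|y| + 1)) Metric.isOpen_ball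
    (convex_ball _ _).isPreconnected
    (fun k z _ => (hasDerivAt_pow k z).div_const _) ?_ (by simp) (summable_besselPhi n y)
    (by simp)
  · refine h.congr_deriv ?_
    rw [(hs y).tsum_eq_zero_add]
    simp only [Nat.cast_zero, zero_mul, zero_div, zero_add]
    refine tsum_congr fun k => ?_
    simpa using key k y
  · intro k z hz
    rw [mem_ball_zero_iff, Real.norm_eq_abs] at hz
    rw [Real.norm_eq_abs, abs_div, abs_mul, abs_pow, Nat.abs_cast,
      abs_of_nonneg (by positivity : (0 : ℝ) ≤ (k.factorial : ℝ) * ((k + n).factorial : ℝ))]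
    gcongr

theorem besselPhi_zero_eq (y : ℝ) :
    besselPhi 0 y = besselPhi 1 y + y * besselPhi 2 y := by
  have h2 := ((summable_besselPhi 2 y).mul_left y).hasSum
  have h3 : HasSum (fun k : ℕ => (k : ℝ) * (y ^ k /
      ((k.factorial : ℝ) * ((k + 1).factorial : ℝ)))) (y * besselPhi 2 y) := by
    rw [← hasSum_nat_add_iff' 1]
    refine h2.congr_of_eq (fun k => ?_) ?_
    · rw [show k + 1 + 1 = k + 2 by ring, Nat.factorial_succ k]
      have := Nat.factorial_ne_zero k
      have := Nat.factorial_ne_zero (k + 2)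
      push_cast
      field_simp
      ring
    · simp [besselPhi, tsum_mul_left]
  refine HasSum.tsum_eq ?_
  refine ((summable_besselPhi 1 y).hasSum.add h3).congr_of_eq (fun k => ?_) rfl
  have := Nat.factorial_ne_zero k
  rw [Nat.factorial_succ, add_zero]
  push_cast
  field_simp
  ring

theorem besselPhi_pos (n : ℕ) {y : ℝ} (hy : 0 ≤ y) : 0 < besselPhi n y :=
  (summable_besselPhi n y).tsum_pos (fun k => by positivity) 0 (by positivity)

theorem besselI_zero_pos (x : ℝ) : 0 < besselI 0 x := by
  rw [besselI_eq_besselPhi, pow_zero, one_mul]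
  exact besselPhi_pos 0 (sq_nonneg _)

theorem besselI_nonneg (n : ℕ) {x : ℝ} (hx : 0 ≤ x) : 0 ≤ besselI n x :=
  tsum_nonneg fun k => by positivity

theorem hasDerivAt_besselI_zero (x : ℝ) : HasDerivAt (besselI 0) (besselI 1 x) x := by
  have h := hasDerivAt_half_sq x
  have h0 : besselI 0 = fun x => besselPhi 0 ((x / 2) ^ 2) := by
    funext x
    simp [besselI_eq_besselPhi]
  rw [h0, besselI_eq_besselPhi]
  refine ((hasDerivAt_besselPhi 0 ((x / 2) ^ 2)).comp x h).congr_deriv ?_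
  ring

theorem hasDerivAt_mul_besselI_one (x : ℝ) :
    HasDerivAt (fun x => x * besselI 1 x) (x * besselI 0 x) x := by
  have h := hasDerivAt_half_sq x
  have h1 : (fun x => x * besselI 1 x) =
      fun x => 2 * ((x / 2) ^ 2 * besselPhi 1 ((x / 2) ^ 2)) := by
    funext x
    rw [besselI_eq_besselPhi]
    ring
  rw [h1, besselI_eq_besselPhi, besselPhi_zero_eq]
  refine ((h.mul ((hasDerivAt_besselPhi 1 ((x / 2) ^ 2)).comp x h)).const_mul 2).congr_deriv ?_
  simp only [Function.comp]
  ring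

theorem hasDerivAt_besselI_one {x : ℝ} (hx : x ≠ 0) :
    HasDerivAt (besselI 1) (besselI 0 x - besselI 1 x / x) x := by
  have h := (hasDerivAt_mul_besselI_one x).div (hasDerivAt_id x) hx
  have h' := h.congr_of_eventuallyEq (f₁ := besselI 1) (by
    filter_upwards [isOpen_ne.mem_nhds hx] with z hz
    have hz' : z ≠ 0 := hz
    simp only [Pi.div_apply, id]
    field_simp)
  refine h'.congr_deriv ?_
  simp only [id]
  field_simp

theorem continuous_besselI_zero : Continuous (besselI 0) :=
  continuous_iff_continuousAt.2 fun x => (hasDerivAt_besselI_zero x).continuousAt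

theorem continuous_besselI_one : Continuous (besselI 1) := by
  have h : Continuous (besselPhi 1) :=
    continuous_iff_continuousAt.2 fun x => (hasDerivAt_besselPhi 1 x).continuousAt
  have h1 : besselI 1 = fun x => (x / 2) ^ 1 * besselPhi 1 ((x / 2) ^ 2) :=
    funext fun x => besselI_eq_besselPhi 1 x
  rw [h1]
  fun_prop

theorem besselI_zero_at_zero : besselI 0 0 = 1 := by
  refine (tsum_eq_single 0 fun k hk => ?_).trans (by simp)
  simp [hk]

theorem besselI_one_at_zero : besselI 1 0 = 0 := by
  simp [besselI_eq_besselPhi]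

/-! ### First-order inequalities between I_0 and I_1 -/

/-- A function with `f' + f ≥ 0` keeps a nonnegative sign. -/
theorem nonneg_of_deriv_add_nonneg {f f' : ℝ → ℝ} {a : ℝ} (hc : Continuous f) (ha : 0 ≤ f a)
    (hd : ∀ x, a < x → HasDerivAt f (f' x) x) (h : ∀ x, a < x → 0 ≤ f' x + f x)
    {x : ℝ} (hx : a ≤ x) : 0 ≤ f x := by
  have hm : MonotoneOn (fun x => Real.exp x * f x) (Set.Ici a) := by
    refine monotoneOn_of_hasDerivWithinAt_nonneg
      (f' := fun x => Real.exp x * f x + Real.exp x * f' x) (convex_Ici a)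
      (by fun_prop) (fun x hx => ?_) (fun x hx => ?_)
    · rw [interior_Ici] at hx
      exact ((Real.hasDerivAt_exp x).mul (hd x hx)).hasDerivWithinAt
    · rw [interior_Ici] at hx
      rw [← mul_add]
      exact mul_nonneg (Real.exp_pos x).le (by linarith [h x hx])
  have h1 : Real.exp a * f a ≤ Real.exp x * f x := hm Set.self_mem_Ici hx hx
  have h2 : 0 ≤ Real.exp x * f x := le_trans (by positivity) h1
  exact nonneg_of_mul_nonneg_right h2 (Real.exp_pos x)

theorem besselI_one_le_besselI_zero {x : ℝ} (hx : 0 ≤ x) : besselI 1 x ≤ besselI 0 x := by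
  have h := nonneg_of_deriv_add_nonneg (f := fun x => besselI 0 x - besselI 1 x)
    (f' := fun x => besselI 1 x - (besselI 0 x - besselI 1 x / x)) (a := 0)
    (continuous_besselI_zero.sub continuous_besselI_one)
    (by simp [besselI_zero_at_zero, besselI_one_at_zero])
    (fun x hx => (hasDerivAt_besselI_zero x).sub (hasDerivAt_besselI_one hx.ne'))
    (fun x hx => by
      have := div_nonneg (besselI_nonneg 1 hx.le) hx.le
      linarith) hx
  linarith

theorem besselI_one_mul_le {x : ℝ} (hx : 0 ≤ x) :
    (2 * x + 1) * besselI 1 x ≤ 2 * x * besselI 0 x := by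
  have h0 := continuous_besselI_zero
  have h1 := continuous_besselI_one
  have h := nonneg_of_deriv_add_nonneg
    (f := fun x => 2 * x * besselI 0 x - (2 * x + 1) * besselI 1 x)
    (f' := fun x => (2 * 1 * besselI 0 x + 2 * x * besselI 1 x) -
      (2 * 1 * besselI 1 x + (2 * x + 1) * (besselI 0 x - besselI 1 x / x))) (a := 0)
    (by fun_prop) (by simp [besselI_one_at_zero])
    (fun x hx => (((hasDerivAt_id x).const_mul 2).mul (hasDerivAt_besselI_zero x)).sub
      ((((hasDerivAt_id x).const_mul 2).add_const 1).mul (hasDerivAt_besselI_one hx.ne')))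
    (fun x hx => by
      have h2 := div_nonneg (besselI_nonneg 1 hx.le) hx.le
      have h3 := besselI_one_le_besselI_zero hx.le
      have h4 : x * (besselI 1 x / x) = besselI 1 x := mul_div_cancel₀ _ hx.ne'
      linear_combination h2 + h3 - 2 * h4) hx
  linarith

theorem le_besselI_one_mul {x : ℝ} (hx : 1 / 2 ≤ x) :
    (2 * x - 1) * besselI 0 x ≤ (2 * x + 1) * besselI 1 x := by
  have h0 := continuous_besselI_zero
  have h1 := continuous_besselI_one
  have h := nonneg_of_deriv_add_nonneg
    (f := fun x => (2 * x + 1) * besselI 1 x - (2 * x - 1) * besselI 0 x)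
    (f' := fun x => (2 * 1 * besselI 1 x + (2 * x + 1) * (besselI 0 x - besselI 1 x / x)) -
      (2 * 1 * besselI 0 x + (2 * x - 1) * besselI 1 x)) (a := 1 / 2)
    (by fun_prop) (by
      have := besselI_nonneg 1 (show (0 : ℝ) ≤ 1 / 2 by norm_num)
      norm_num at this ⊢
      linarith)
    (fun x hx => ((((hasDerivAt_id x).const_mul 2).add_const 1).mul
        (hasDerivAt_besselI_one (by linarith : (0 : ℝ) < x).ne')).sub
      ((((hasDerivAt_id x).const_mul 2).sub_const 1).mul (hasDerivAt_besselI_zero x)))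
    (fun x hx => by
      have hx0 : 0 < x := by linarith
      have h2 := div_nonneg (besselI_nonneg 1 hx0.le) hx0.le
      have h4 : x * (besselI 1 x / x) = besselI 1 x := mul_div_cancel₀ _ hx0.ne'
      have h5 : 0 ≤ (2 * x - 1) * (besselI 1 x / x) := mul_nonneg (by linarith) h2
      linear_combination h5 + 4 * h4) hx
  linarith

theorem besselI_one_le_half_mul {x : ℝ} (hx : 0 ≤ x) :
    besselI 1 x ≤ x / 2 * besselI 0 x := by
  unfold besselI
  rw [← tsum_mul_left]
  refine (summable_besselI 1 x).tsum_le_tsum (fun k => ?_) ((summable_besselI 0 x).mul_left _)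
  rw [pow_succ, mul_comm ((x / 2) ^ (2 * k)), mul_div_assoc, add_zero]
  gcongr
  exact zero_le_one

/-- A coefficientwise comparison in y = (x/2)²: the two sides differ by k(k-1) times the
coefficients of φ_1. It supplies lower bounds for I_1 at moderate x, where the asymptotic
inequalities need a starting point. -/
theorem four_mul_besselI_zero_le {x : ℝ} (hx : 0 ≤ x) :
    4 * x * besselI 0 x ≤ (8 + x ^ 2) * besselI 1 x := by
  rw [besselI_eq_besselPhi, besselI_eq_besselPhi]
  set y := (x / 2) ^ 2 with hy
  have hy0 : 0 ≤ y := sq_nonneg _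
  suffices h : 2 * besselPhi 0 y ≤ 2 * besselPhi 1 y + y * besselPhi 1 y by
    have h2 : x ^ 2 = 4 * y := by rw [hy]; ring
    rw [h2]
    nlinarith [mul_le_mul_of_nonneg_left h hx]
  have h2 := ((summable_besselPhi 1 y).mul_left y).hasSum
  have h3 : HasSum (fun k : ℕ => (k : ℝ) * ((k : ℝ) + 1) * (y ^ k /
      ((k.factorial : ℝ) * ((k + 1).factorial : ℝ)))) (y * besselPhi 1 y) := by
    rw [← hasSum_nat_add_iff' 1]
    refine h2.congr_of_eq (fun k => ?_) ?_
    · rw [Nat.factorial_succ (k + 1), Nat.factorial_succ k]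
      have := Nat.factorial_ne_zero k
      push_cast
      field_simp
      ring
    · simp [besselPhi, tsum_mul_left]
  refine hasSum_le (fun k => ?_) ((summable_besselPhi 0 y).hasSum.mul_left 2)
    (((summable_besselPhi 1 y).hasSum.mul_left 2).add h3)
  have hf : (0 : ℝ) < k.factorial := by exact_mod_cast Nat.factorial_pos k
  rw [Nat.factorial_succ, add_zero]
  push_cast
  have hk : (0 : ℝ) ≤ (k : ℝ) * (k - 1) := by
    rcases Nat.eq_zero_or_pos k with rfl | h
    · simp
    · have : (1 : ℝ) ≤ k := by exact_mod_cast h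
      exact mul_nonneg (by linarith) (by linarith)
  have e : 2 * (y ^ k / ((k.factorial : ℝ) * (((k : ℝ) + 1) * k.factorial))) +
      (k : ℝ) * ((k : ℝ) + 1) * (y ^ k / ((k.factorial : ℝ) * (((k : ℝ) + 1) * k.factorial))) -
      2 * (y ^ k / ((k.factorial : ℝ) * k.factorial)) =
      (k : ℝ) * (k - 1) * (y ^ k / ((k.factorial : ℝ) * (((k : ℝ) + 1) * k.factorial))) := by
    field_simp
    ring
  have : 0 ≤ (k : ℝ) * (k - 1) *
      (y ^ k / ((k.factorial : ℝ) * (((k : ℝ) + 1) * k.factorial))) :=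
    mul_nonneg hk (by positivity)
  linarith

/-- A bootstrap of `le_besselI_one_mul`. The constant 14/25 = 2 · 7/25 is what the derivative in
`hasDerivAt_quadratic_mul_besselI_sub` requires at c = -7/25. -/
theorem le_besselI_one_mul_sharp {x : ℝ} (hx : 5 / 4 ≤ x) :
    (2 * x - 1) * besselI 0 x ≤ (2 * x + 14 / 25) * besselI 1 x := by
  have h0 := continuous_besselI_zero
  have h1 := continuous_besselI_one
  have h := nonneg_of_deriv_add_nonneg
    (f := fun x => (2 * x + 14 / 25) * besselI 1 x - (2 * x - 1) * besselI 0 x)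
    (f' := fun x => (2 * 1 * besselI 1 x + (2 * x + 14 / 25) * (besselI 0 x - besselI 1 x / x)) -
      (2 * 1 * besselI 0 x + (2 * x - 1) * besselI 1 x)) (a := 5 / 4)
    (by fun_prop) (by
      have h2 := four_mul_besselI_zero_le (show (0 : ℝ) ≤ 5 / 4 by norm_num)
      have h3 := besselI_zero_pos (5 / 4)
      norm_num at h2 ⊢
      linarith)
    (fun x hx => ((((hasDerivAt_id x).const_mul 2).add_const _).mul
        (hasDerivAt_besselI_one (by linarith : (0 : ℝ) < x).ne')).sub
      ((((hasDerivAt_id x).const_mul 2).sub_const 1).mul (hasDerivAt_besselI_zero x)))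
    (fun x hx => by
      have hx0 : 0 < x := by linarith
      have h2 := le_besselI_one_mul (show 1 / 2 ≤ x by linarith)
      have h3 := besselI_zero_pos x
      have h4 : x * (besselI 1 x / x) = besselI 1 x := mul_div_cancel₀ _ hx0.ne'
      have h5 := div_nonneg (besselI_nonneg 1 hx0.le) hx0.le
      -- Up to the factor 25, the condition f' + f ≥ 0 is 11 I_0 ≤ 39 I_1 - 14 I_1/x. After
      -- multiplication by 2x - 1, the weaker bound `h2` eliminates I_0.
      have h7 : (2 * x - 1) * (11 * besselI 0 x) ≤
          (2 * x - 1) * (39 * besselI 1 x - 14 * (besselI 1 x / x)) := by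
        rw [← h4] at h2 ⊢
        rw [mul_div_cancel_left₀ _ hx0.ne']
        set v := besselI 1 x / x
        have h8 : 0 ≤ (x - 5 / 4) * v := mul_nonneg (by linarith) h5
        have h9 : 0 ≤ (x - 5 / 4) * ((x - 5 / 4) * v) := mul_nonneg (by linarith) h8
        linear_combination 11 * h2 + 56 * h9 + 62 * h8 + 4 * h5
      have h8 := le_of_mul_le_mul_left h7 (by linarith)
      linarith) hx
  linarith

/-! ### The uniform bound on x - x²(1 - R²) -/

theorem nonneg_of_deriv_nonneg {f f' : ℝ → ℝ} {a : ℝ} (ha : 0 ≤ f a)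
    (hd : ∀ x, HasDerivAt f (f' x) x) (h : ∀ x, a < x → 0 ≤ f' x)
    {x : ℝ} (hx : a ≤ x) : 0 ≤ f x := by
  have hm : MonotoneOn f (Set.Ici a) := by
    refine monotoneOn_of_hasDerivWithinAt_nonneg (f' := f') (convex_Ici a)
      (fun x _ => (hd x).continuousAt.continuousWithinAt)
      (fun x _ => (hd x).hasDerivWithinAt) (fun x hx => ?_)
    rw [interior_Ici] at hx
    exact h x hx
  exact ha.trans (hm Set.self_mem_Ici hx hx)

theorem hasDerivAt_quadratic_mul_besselI_sub (c x : ℝ) :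
    HasDerivAt (fun x => (x * x - x + c) * (besselI 0 x * besselI 0 x) -
      (x * besselI 1 x) * (x * besselI 1 x))
      (besselI 0 x * ((2 * x - 1) * besselI 0 x - 2 * (x - c) * besselI 1 x)) x := by
  have h0 := hasDerivAt_besselI_zero x
  have h1 := hasDerivAt_mul_besselI_one x
  have hid := hasDerivAt_id' x
  refine (((((hid.mul hid).sub hid).add_const c).mul (h0.mul h0)).sub
    (h1.mul h1)).congr_deriv ?_
  simp only [Pi.mul_apply, Pi.sub_apply]
  ring

theorem sq_mul_besselI_one_le {x : ℝ} (hx : 0 ≤ x) :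
    (x * besselI 1 x) ^ 2 ≤ (x ^ 2 - x + 7 / 25) * besselI 0 x ^ 2 := by
  rcases le_total x 1 with h | h
  · have h1 : (x * besselI 1 x) ^ 2 ≤ (x * (x / 2 * besselI 0 x)) ^ 2 := by
      have := besselI_nonneg 1 hx
      have := besselI_one_le_half_mul hx
      gcongr
    have h2 : x ^ 4 / 4 ≤ x ^ 2 - x + 7 / 25 := by
      -- 0.62 approximates (√5 - 1)/2, the minimizer on [0, 1] of x² - x + 7/25 - x⁴/4; this is the
      -- cofactor left after nearly splitting off (x - 0.62)².
      have h3 : 0 ≤ 0.7117 - 0.31 * x - 0.25 * x ^ 2 := by nlinarith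
      nlinarith [mul_nonneg (sq_nonneg (x - 0.62)) h3]
    nlinarith [mul_le_mul_of_nonneg_right h2 (sq_nonneg (besselI 0 x))]
  · have h2 := nonneg_of_deriv_nonneg (a := 1) (by
        have h1 := besselI_one_le_half_mul (zero_le_one (α := ℝ))
        have h2 := besselI_nonneg 1 (zero_le_one (α := ℝ))
        norm_num
        nlinarith) (hasDerivAt_quadratic_mul_besselI_sub (7 / 25)) (fun x hx => by
        refine mul_nonneg (besselI_zero_pos x).le ?_
        have h3 := besselI_one_mul_le (zero_le_one.trans hx.le)
        have h4 := besselI_zero_pos x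
        have h5 : (2 * x + 1) * (2 * (x - 7 / 25) * besselI 1 x) ≤
            (2 * x + 1) * ((2 * x - 1) * besselI 0 x) := by
          have h6 := mul_le_mul_of_nonneg_left h3 (show 0 ≤ 2 * (x - 7 / 25) by linarith)
          have h7 := mul_nonneg (sub_nonneg.2 hx.le) h4.le
          linear_combination h6 + 28 / 25 * h7 + 3 / 25 * h4
        linarith [le_of_mul_le_mul_left h5 (by linarith)]) h
    linear_combination h2

theorem le_sq_mul_besselI_one {x : ℝ} (hx : 0 ≤ x) :
    (x ^ 2 - x - 7 / 25) * besselI 0 x ^ 2 ≤ (x * besselI 1 x) ^ 2 := by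
  have small : ∀ x : ℝ, 0 ≤ x → x ≤ 5 / 4 →
      (x ^ 2 - x - 7 / 25) * besselI 0 x ^ 2 ≤ (x * besselI 1 x) ^ 2 := by
    intro x hx h
    rcases le_total x 1 with h1 | h1
    · refine le_trans ?_ (sq_nonneg _)
      exact mul_nonpos_of_nonpos_of_nonneg (by nlinarith) (sq_nonneg _)
    · have h2 := four_mul_besselI_zero_le hx
      have h3 := besselI_zero_pos x
      have h4 := besselI_nonneg 1 hx
      have h5 : 2 / 5 * besselI 0 x ≤ x * besselI 1 x := by nlinarith
      have h6 : x ^ 2 - x - 7 / 25 ≤ (2 / 5) ^ 2 := by nlinarith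
      calc _ ≤ (2 / 5) ^ 2 * besselI 0 x ^ 2 := by gcongr
        _ = (2 / 5 * besselI 0 x) ^ 2 := by ring
        _ ≤ _ := by gcongr
  rcases le_total x (5 / 4) with h | h
  · exact small x hx h
  · have h2 := nonneg_of_deriv_nonneg (a := 5 / 4) (by
        have := small (5 / 4) (by norm_num) le_rfl
        rw [Pi.neg_apply]
        linear_combination this)
        (fun x => (hasDerivAt_quadratic_mul_besselI_sub (-(7 / 25)) x).neg) (fun x hx => by
        have h3 := mul_nonneg (besselI_zero_pos x).le
          (sub_nonneg.2 (le_besselI_one_mul_sharp hx.le))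
        linear_combination h3) h
    rw [Pi.neg_apply] at h2
    linear_combination h2

theorem besselRatio_sq_le_one {x : ℝ} (hx : 0 ≤ x) : besselRatio x ^ 2 ≤ 1 := by
  refine pow_le_one₀ (div_nonneg (besselI_nonneg 1 hx) (besselI_zero_pos x).le) ?_
  exact (div_le_one (besselI_zero_pos x)).2 (besselI_one_le_besselI_zero hx)

theorem abs_sub_sq_mul_besselRatio_le {x : ℝ} (hx : 0 ≤ x) :
    |x - x ^ 2 * (1 - besselRatio x ^ 2)| ≤ 7 / 25 := by
  have h0 := besselI_zero_pos x
  have h1 : x ^ 2 * besselRatio x ^ 2 = (x * besselI 1 x) ^ 2 / besselI 0 x ^ 2 := by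
    rw [besselRatio]
    field_simp
  have h2 : x ^ 2 * besselRatio x ^ 2 ≤ x ^ 2 - x + 7 / 25 := by
    rw [h1, div_le_iff₀ (by positivity)]
    exact sq_mul_besselI_one_le hx
  have h3 : x ^ 2 - x - 7 / 25 ≤ x ^ 2 * besselRatio x ^ 2 := by
    rw [h1, le_div_iff₀ (by positivity)]
    exact le_sq_mul_besselI_one hx
  rw [abs_le]
  constructor <;> linarith

/-! ### Kummer's formula through formal power series -/

/-- The Taylor series of `I_0`. -/
def besselSeries : PowerSeries ℝ :=
  PowerSeries.mk fun n => if Even n then 1 / (2 ^ n * ((n / 2).factorial : ℝ) ^ 2) else 0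

theorem coeff_besselSeries_even (k : ℕ) :
    PowerSeries.coeff (2 * k) besselSeries = 1 / (2 ^ (2 * k) * (k.factorial : ℝ) ^ 2) := by
  simp [besselSeries]

theorem coeff_besselSeries_odd (k : ℕ) : PowerSeries.coeff (2 * k + 1) besselSeries = 0 := by
  simp [besselSeries]

theorem coeff_besselSeries_add_two (n : ℕ) :
    PowerSeries.coeff (n + 2) besselSeries * ((n : ℝ) + 2) ^ 2 =
      PowerSeries.coeff n besselSeries := by
  obtain ⟨k, rfl | rfl⟩ := n.even_or_odd'
  · rw [show 2 * k + 2 = 2 * (k + 1) by ring, coeff_besselSeries_even, coeff_besselSeries_even,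
      Nat.factorial_succ]
    have := Nat.factorial_ne_zero k
    push_cast
    field_simp
    ring
  · rw [show 2 * k + 1 + 2 = 2 * (k + 1) + 1 by ring, coeff_besselSeries_odd,
      coeff_besselSeries_odd, zero_mul]

open PowerSeries in
theorem besselSeries_ode :
    X * d⁄dX ℝ (d⁄dX ℝ besselSeries) + d⁄dX ℝ besselSeries = X * besselSeries := by
  ext n
  rcases n with _ | n
  · have := coeff_besselSeries_odd 0
    rw [map_add, coeff_zero_X_mul, coeff_zero_X_mul, coeff_derivative, this]
    simp
  · rw [map_add, coeff_succ_X_mul, coeff_succ_X_mul, coeff_derivative, coeff_derivative,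
      ← coeff_besselSeries_add_two n]
    push_cast
    ring

open PowerSeries in
theorem derivative_exp_mul (F : PowerSeries ℝ) :
    d⁄dX ℝ (PowerSeries.exp ℝ * F) = PowerSeries.exp ℝ * (F + d⁄dX ℝ F) := by
  rw [Derivation.leibniz, PowerSeries.derivative_exp, smul_eq_mul, smul_eq_mul]
  ring

open PowerSeries in
-- Bessel's equation turns into X P'' + P' = 2 X P' + P for P = exp · I_0. Its coefficients satisfy
-- the two-term recurrence (n+1)² p_{n+1} = (2n+1) p_n, which the Gamma quotient solves.
theorem coeff_exp_mul_besselSeries (n : ℕ) :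
    coeff n (PowerSeries.exp ℝ * besselSeries) =
      2 ^ n * Real.Gamma (n + 1 / 2) / (√Real.pi * (n.factorial : ℝ) ^ 2) := by
  set P := PowerSeries.exp ℝ * besselSeries with hP
  have ode : X * d⁄dX ℝ (d⁄dX ℝ P) + d⁄dX ℝ P = X * d⁄dX ℝ P + X * d⁄dX ℝ P + P := by
    rw [hP, derivative_exp_mul, derivative_exp_mul, map_add]
    linear_combination PowerSeries.exp ℝ * besselSeries_ode
  have hrec : ∀ n : ℕ, coeff (n + 1) P * ((n : ℝ) + 1) ^ 2 = (2 * n + 1) * coeff n P := by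
    intro n
    have h := congrArg (coeff n) ode
    rcases n with _ | n
    · simp only [map_add, coeff_zero_X_mul, coeff_derivative] at h
      push_cast at h ⊢
      linear_combination h
    · simp only [map_add, coeff_succ_X_mul, coeff_derivative] at h
      push_cast at h ⊢
      linear_combination h
  induction n with
  | zero =>
    have h0 := coeff_besselSeries_even 0
    have : √Real.pi ≠ 0 := by positivity
    simp at h0
    rw [Nat.cast_zero, zero_add, Real.Gamma_one_half_eq]
    simp [hP, h0, this]
  | succ n ih =>
    have h := hrec n
    rw [ih] at h
    have h1 : ((n : ℝ) + 1) ^ 2 ≠ 0 := by positivity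
    refine mul_right_cancel₀ h1 (h.trans ?_)
    have : √Real.pi ≠ 0 := by positivity
    have := Nat.factorial_ne_zero n
    push_cast
    rw [show (n : ℝ) + 1 + 1 / 2 = (n + 1 / 2) + 1 by ring,
      Real.Gamma_add_one (by positivity), Nat.factorial_succ]
    push_cast
    field_simp
    ring

theorem hasSum_coeff_mul {F G : PowerSeries ℝ} {x a b : ℝ}
    (hF : HasSum (fun n => PowerSeries.coeff n F * x ^ n) a)
    (hG : HasSum (fun n => PowerSeries.coeff n G * x ^ n) b) :
    HasSum (fun n => PowerSeries.coeff n (F * G) * x ^ n) (a * b) := by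
  have e : (fun n => PowerSeries.coeff n (F * G) * x ^ n) = fun n =>
      ∑ kl ∈ Finset.HasAntidiagonal.antidiagonal n, (PowerSeries.coeff kl.1 F * x ^ kl.1) *
        (PowerSeries.coeff kl.2 G * x ^ kl.2) := by
    funext n
    rw [PowerSeries.coeff_mul, Finset.sum_mul]
    refine Finset.sum_congr rfl fun kl hkl => ?_
    rw [← Finset.HasAntidiagonal.mem_antidiagonal.1 hkl, pow_add]
    ring
  rw [e, ← hF.tsum_eq, ← hG.tsum_eq, tsum_mul_tsum_eq_tsum_sum_antidiagonal_of_summable_norm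
    hF.summable.norm hG.summable.norm]
  exact (summable_norm_sum_mul_antidiagonal_of_summable_norm
    hF.summable.norm hG.summable.norm).of_norm.hasSum

theorem hasSum_real_exp (x : ℝ) : HasSum (fun n : ℕ => x ^ n / (n.factorial : ℝ)) (Real.exp x) := by
  rw [Real.exp_eq_exp_ℝ]
  exact NormedSpace.expSeries_div_hasSum_exp x

theorem hasSum_coeff_exp (x : ℝ) :
    HasSum (fun n => PowerSeries.coeff n (PowerSeries.exp ℝ) * x ^ n) (Real.exp x) := by
  refine (hasSum_real_exp x).congr_of_eq (fun n => ?_) rfl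
  rw [PowerSeries.coeff_exp, eq_ratCast]
  push_cast
  ring

theorem hasSum_coeff_besselSeries (x : ℝ) :
    HasSum (fun n => PowerSeries.coeff n besselSeries * x ^ n) (besselI 0 x) := by
  have hi : Function.Injective fun k : ℕ => 2 * k := fun a b h => by simpa using h
  rw [← hi.hasSum_iff]
  · refine (summable_besselI 0 x).hasSum.congr_of_eq (fun k => ?_) rfl
    simp only [Function.comp]
    rw [coeff_besselSeries_even, add_zero, add_zero, div_pow]
    field_simp
  · intro n hn
    obtain ⟨k, rfl | rfl⟩ := n.even_or_odd'
    · exact absurd ⟨k, rfl⟩ hn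
    · rw [coeff_besselSeries_odd, zero_mul]

theorem hasSum_coeff_derivative_besselSeries (x : ℝ) :
    HasSum (fun n => PowerSeries.coeff n (PowerSeries.derivative ℝ besselSeries) * x ^ n)
      (besselI 1 x) := by
  have hi : Function.Injective fun k : ℕ => 2 * k + 1 := fun a b h => by simpa using h
  rw [← hi.hasSum_iff]
  · refine (summable_besselI 1 x).hasSum.congr_of_eq (fun k => ?_) rfl
    simp only [Function.comp]
    rw [PowerSeries.coeff_derivative, show 2 * k + 1 + 1 = 2 * (k + 1) by ring,
      coeff_besselSeries_even, Nat.factorial_succ, div_pow]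
    have := Nat.factorial_ne_zero k
    push_cast
    field_simp
    ring
  · intro n hn
    obtain ⟨k, rfl | rfl⟩ := n.even_or_odd'
    · rw [PowerSeries.coeff_derivative, coeff_besselSeries_odd, zero_mul, zero_mul]
    · exact absurd ⟨k, rfl⟩ hn

/-- Kummer's formula for `₁F₁(3/2; 1; y)` in terms of Bessel functions at `y / 2`. -/
theorem hasSum_Gamma_three_half (y : ℝ) :
    HasSum (fun n : ℕ => Real.Gamma (n + 1 / 2 + 1) / (n.factorial : ℝ) ^ 2 * y ^ n)
      (√Real.pi / 2 * (Real.exp (y / 2) *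
        ((1 + y) * besselI 0 (y / 2) + y * besselI 1 (y / 2)))) := by
  set x := y / 2 with hx
  have h0 := hasSum_coeff_mul (hasSum_coeff_exp x) (hasSum_coeff_besselSeries x)
  have h1 := hasSum_coeff_mul (hasSum_coeff_exp x) (F := PowerSeries.exp ℝ)
    (G := besselSeries + PowerSeries.derivative ℝ besselSeries)
    (((hasSum_coeff_besselSeries x).add
      (hasSum_coeff_derivative_besselSeries x)).congr_of_eq
      (fun n => by rw [map_add, add_mul]) rfl)
  -- Since Γ(n+3/2) = (n+1/2) Γ(n+1/2), the target is (√π/2)(P + 2xP') with P = exp · I_0; this is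
  -- the series of xP'.
  have h2 : HasSum (fun n : ℕ =>
      (n : ℝ) * PowerSeries.coeff n (PowerSeries.exp ℝ * besselSeries) * x ^ n)
      (x * (Real.exp x * (besselI 0 x + besselI 1 x))) := by
    rw [← hasSum_nat_add_iff' 1]
    refine (h1.mul_left x).congr_of_eq (fun n => ?_) (by simp)
    rw [← derivative_exp_mul, PowerSeries.coeff_derivative]
    push_cast
    ring
  refine ((h0.add (h2.mul_left 2)).mul_left (√Real.pi / 2)).congr_of_eq (fun n => ?_) ?_
  · rw [coeff_exp_mul_besselSeries, Real.Gamma_add_one (by positivity), hx, div_pow]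
    have : √Real.pi ≠ 0 := by positivity
    have := Nat.factorial_ne_zero n
    field_simp
    ring
  · rw [hx]
    ring

/-! ### Moments of the Rician weight -/

/-- The Rician weight `exp(-γ (1 + t)) I_0(2 γ √t)`. -/
def ricianWeight (γ t : ℝ) : ℝ := Real.exp (-γ * (1 + t)) * besselI 0 (2 * γ * √t)

/-- Expanding I_0 makes each term a Gamma integral; positivity of the terms justifies the
interchange. The sum S stays abstract so that each moment can supply its own closed form. -/
theorem integral_rpow_mul_ricianWeight {γ s S : ℝ} (hγ : 0 < γ) (hs : 0 ≤ s)
    (hS : HasSum (fun k : ℕ => Real.Gamma (k + s + 1) / (k.factorial : ℝ) ^ 2 * γ ^ k) S) :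
    ∫ t in Set.Ioi (0 : ℝ), t ^ s * ricianWeight γ t =
      Real.exp (-γ) * (1 / γ) ^ (s + 1) * S := by
  set F : ℕ → ℝ → ℝ := fun k t => Real.exp (-γ) * (γ ^ (2 * k) / (k.factorial : ℝ) ^ 2) *
    (t ^ ((k : ℝ) + s + 1 - 1) * Real.exp (-(γ * t))) with hF
  have hI : ∀ k, ∫ t in Set.Ioi (0 : ℝ), F k t = Real.exp (-γ) * (1 / γ) ^ (s + 1) *
      (Real.Gamma (k + s + 1) / (k.factorial : ℝ) ^ 2 * γ ^ k) := by
    intro k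
    rw [hF]
    simp only []
    rw [integral_const_mul, Real.integral_rpow_mul_exp_neg_mul_Ioi (by positivity) hγ,
      add_assoc, Real.rpow_add (by positivity), Real.rpow_natCast, one_div, inv_pow]
    field_simp
    ring
  have hpos : ∀ k, 0 < ∫ t in Set.Ioi (0 : ℝ), F k t := by
    intro k
    rw [hI]
    have := Real.Gamma_pos_of_pos (show 0 < (k : ℝ) + s + 1 by positivity)
    positivity
  have hsum := hS.mul_left (Real.exp (-γ) * (1 / γ) ^ (s + 1))
  have h := hasSum_integral_of_summable_integral_norm (μ := volume.restrict (Set.Ioi (0 : ℝ)))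
    -- A nonintegrable function has integral 0 by convention, so a nonzero value certifies
    -- integrability.
    (F := F) (fun k => Integrable.of_integral_ne_zero (hpos k).ne') ?_
  · refine Eq.trans ?_ (h.unique (hsum.congr_of_eq (fun k => (hI k).symm) rfl))
    refine setIntegral_congr_fun measurableSet_Ioi fun t ht => ?_
    have ht : 0 < t := ht
    simp only [ricianWeight, besselI]
    rw [← mul_assoc, ← tsum_mul_left]
    refine tsum_congr fun k => ?_
    rw [hF]
    simp only []
    rw [show -γ * (1 + t) = -γ + -(γ * t) by ring, Real.exp_add, add_sub_cancel_right,
      Real.rpow_add ht, Real.rpow_natCast, add_zero, add_zero, pow_mul,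
      show (2 * γ * √t / 2) ^ 2 = γ ^ 2 * √t ^ 2 by ring, Real.sq_sqrt ht.le, mul_pow, ← pow_mul]
    ring
  · refine hsum.summable.congr fun k => ?_
    rw [← hI]
    refine setIntegral_congr_fun measurableSet_Ioi fun t ht => ?_
    have ht : 0 < t := ht
    rw [Real.norm_of_nonneg]
    rw [hF]
    positivity

theorem integral_ricianWeight {γ : ℝ} (hγ : 0 < γ) :
    ∫ t in Set.Ioi (0 : ℝ), ricianWeight γ t = 1 / γ := by
  have h := integral_rpow_mul_ricianWeight (S := Real.exp γ) hγ le_rfl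
    ((hasSum_real_exp γ).congr_of_eq (fun k => by
      have := Nat.factorial_ne_zero k
      rw [add_zero, Real.Gamma_nat_eq_factorial]
      field_simp) rfl)
  simp only [Real.rpow_zero, one_mul, zero_add, Real.rpow_one] at h
  rw [h, mul_right_comm, ← Real.exp_add, neg_add_cancel, Real.exp_zero, one_mul]

theorem hasSum_nat_mul_pow_div_factorial (x : ℝ) :
    HasSum (fun k : ℕ => (k : ℝ) * (x ^ k / (k.factorial : ℝ))) (x * Real.exp x) := by
  rw [← hasSum_nat_add_iff' 1]
  refine ((hasSum_real_exp x).mul_left x).congr_of_eq (fun k => ?_) (by simp)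
  have := Nat.factorial_ne_zero k
  rw [Nat.factorial_succ]
  push_cast
  field_simp
  ring

theorem integral_mul_ricianWeight {γ : ℝ} (hγ : 0 < γ) :
    ∫ t in Set.Ioi (0 : ℝ), t * ricianWeight γ t = (1 + γ) / γ ^ 2 := by
  have h := integral_rpow_mul_ricianWeight (S := Real.exp γ + γ * Real.exp γ) hγ zero_le_one
    (((hasSum_real_exp γ).add (hasSum_nat_mul_pow_div_factorial γ)).congr_of_eq (fun k => by
      have := Nat.factorial_ne_zero k
      rw [Real.Gamma_add_one (by positivity), Real.Gamma_nat_eq_factorial]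
      field_simp
      ring) rfl)
  simp only [Real.rpow_one] at h
  rw [h, show (1 : ℝ) + 1 = (2 : ℕ) by norm_num, Real.rpow_natCast,
    show Real.exp (-γ) * (1 / γ) ^ 2 * (Real.exp γ + γ * Real.exp γ) =
      (Real.exp (-γ) * Real.exp γ) * ((1 + γ) * (1 / γ) ^ 2) by ring,
    ← Real.exp_add, neg_add_cancel, Real.exp_zero]
  field_simp

theorem integral_sqrt_mul_ricianWeight {γ S : ℝ} (hγ : 0 < γ)
    (hS : HasSum (fun k : ℕ => Real.Gamma (k + 1 / 2 + 1) / (k.factorial : ℝ) ^ 2 * γ ^ k) S) :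
    ∫ t in Set.Ioi (0 : ℝ), √t * ricianWeight γ t =
      Real.exp (-γ) / (γ * √γ) * S := by
  have h := integral_rpow_mul_ricianWeight hγ (by norm_num) hS
  simp only [← Real.sqrt_eq_rpow] at h
  rw [h, Real.rpow_add (by positivity), Real.rpow_one, ← Real.sqrt_eq_rpow,
    Real.sqrt_div zero_le_one, Real.sqrt_one]
  field_simp

theorem integral_sqrt_mul_ricianWeight_eq_gHat {γ : ℝ} (hγ : 0 < γ) :
    ∫ t in Set.Ioi (0 : ℝ), √t * ricianWeight γ t = 2 * gHat γ := by
  rw [integral_sqrt_mul_ricianWeight hγ (hasSum_Gamma_three_half γ), gHat,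
    Real.sqrt_div Real.pi_pos.le, show -γ / 2 = -γ + γ / 2 by ring, Real.exp_add]
  have : √γ ≠ 0 := by positivity
  field_simp
  ring

theorem ricianWeight_pos (γ t : ℝ) : 0 < ricianWeight γ t :=
  mul_pos (Real.exp_pos _) (besselI_zero_pos _)

theorem integrableOn_ricianWeight {γ : ℝ} (hγ : 0 < γ) :
    IntegrableOn (ricianWeight γ) (Set.Ioi 0) :=
  Integrable.of_integral_ne_zero (by rw [integral_ricianWeight hγ]; positivity)

theorem integrableOn_mul_ricianWeight {γ : ℝ} (hγ : 0 < γ) :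
    IntegrableOn (fun t => t * ricianWeight γ t) (Set.Ioi 0) :=
  Integrable.of_integral_ne_zero (by rw [integral_mul_ricianWeight hγ]; positivity)

theorem gHat_pos {γ : ℝ} (hγ : 0 < γ) : 0 < gHat γ := by
  have h0 := besselI_zero_pos (γ / 2)
  have h1 := besselI_nonneg 1 (show 0 ≤ γ / 2 by positivity)
  unfold gHat
  have := Real.pi_pos
  positivity

theorem integrableOn_sqrt_mul_ricianWeight {γ : ℝ} (hγ : 0 < γ) :
    IntegrableOn (fun t => √t * ricianWeight γ t) (Set.Ioi 0) :=
  Integrable.of_integral_ne_zero (by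
    rw [integral_sqrt_mul_ricianWeight_eq_gHat hγ]
    have := gHat_pos hγ
    positivity)

/-! ### The bound γĝ(γ) ≤ 5/6 -/

/-- Equality holds at k = 0 and k = 1, so the resulting bound on ĝ is accurate for small γ, and its
majorant series sums to exponentials. -/
theorem Gamma_three_half_le (k : ℕ) :
    Real.Gamma (k + 1 / 2 + 1) ≤ √Real.pi / 2 * ((1 + k / 2) * (k.factorial : ℝ)) := by
  induction k with
  | zero =>
    rw [Nat.cast_zero, zero_add, Real.Gamma_add_one (by norm_num), Real.Gamma_one_half_eq]
    apply le_of_eq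
    simp
    ring
  | succ k ih =>
    rw [Nat.factorial_succ]
    push_cast
    rw [show (k : ℝ) + 1 + 1 / 2 + 1 = k + 1 / 2 + 1 + 1 by ring,
      Real.Gamma_add_one (by positivity)]
    have h : 0 ≤ √Real.pi * (k.factorial : ℝ) * k := by positivity
    have h2 := mul_le_mul_of_nonneg_left ih (show 0 ≤ (k : ℝ) + 1 / 2 + 1 by positivity)
    linear_combination h2 + h / 8

theorem gHat_le_of_small {γ : ℝ} (hγ : 0 < γ) :
    gHat γ ≤ √Real.pi / (4 * (γ * √γ)) * (1 + γ / 2) := by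
  have hS := ((hasSum_real_exp γ).add
    ((hasSum_nat_mul_pow_div_factorial γ).div_const 2)).mul_left (√Real.pi / 2)
  have hG := hasSum_Gamma_three_half γ
  have hle := hasSum_le (fun k => ?_) hG hS
  · have h := integral_sqrt_mul_ricianWeight hγ hG
    rw [integral_sqrt_mul_ricianWeight_eq_gHat hγ] at h
    have h2 := mul_le_mul_of_nonneg_left hle
      (show 0 ≤ Real.exp (-γ) / (γ * √γ) by positivity)
    rw [← h] at h2
    have h3 : Real.exp (-γ) / (γ * √γ) * (√Real.pi / 2 * (Real.exp γ + γ * Real.exp γ / 2)) =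
        2 * (√Real.pi / (4 * (γ * √γ)) * (1 + γ / 2)) := by
      rw [Real.exp_neg]
      have : √γ ≠ 0 := by positivity
      field_simp
      ring
    linarith
  · have hf : (0 : ℝ) < k.factorial := by exact_mod_cast Nat.factorial_pos k
    have h := mul_le_mul_of_nonneg_right (Gamma_three_half_le k)
      (show 0 ≤ γ ^ k / (k.factorial : ℝ) ^ 2 by positivity)
    refine (le_of_eq ?_).trans (h.trans (le_of_eq ?_))
    · ring
    · field_simp

theorem mul_gHat_le {γ : ℝ} (hγ : 0.42 ≤ γ) : γ * gHat γ ≤ 5 / 6 := by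
  have hγ0 : 0 < γ := by norm_num at hγ; linarith
  -- Below 3/4 the series majorant is used; above it, 2√t ≤ 1 + t gives 2γĝ ≤ 1 + 1/(2γ), which
  -- equals 5/3 at 3/4.
  rcases le_total γ (3 / 4) with h | h
  · have h1 := mul_le_mul_of_nonneg_left (gHat_le_of_small hγ0) hγ0.le
    refine h1.trans ?_
    have hs : 0 < √γ := by positivity
    have e : γ * (√Real.pi / (4 * (γ * √γ)) * (1 + γ / 2)) =
        √Real.pi * (1 + γ / 2) / (4 * √γ) := by
      field_simp
    rw [e, div_le_iff₀ (by positivity)]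
    refine le_of_sq_le_sq ?_ (by positivity)
    rw [mul_pow, mul_pow, mul_pow, Real.sq_sqrt Real.pi_pos.le, Real.sq_sqrt hγ0.le]
    have h2 := mul_le_mul_of_nonneg_right Real.pi_lt_d2.le (sq_nonneg (1 + γ / 2))
    norm_num at h2 hγ ⊢
    nlinarith
  · have h1 : 2 * gHat γ ≤ 1 / 2 * (1 / γ + (1 + γ) / γ ^ 2) := by
      rw [← integral_sqrt_mul_ricianWeight_eq_gHat hγ0, ← integral_ricianWeight hγ0,
        ← integral_mul_ricianWeight hγ0, ← integral_add (integrableOn_ricianWeight hγ0)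
        (integrableOn_mul_ricianWeight hγ0), ← integral_const_mul]
      refine setIntegral_mono_on (integrableOn_sqrt_mul_ricianWeight hγ0)
        (((integrableOn_ricianWeight hγ0).add (integrableOn_mul_ricianWeight hγ0)).const_mul _)
        measurableSet_Ioi fun t ht => ?_
      have ht : 0 < t := ht
      have h2 : 2 * √t ≤ 1 + t := by nlinarith [sq_nonneg (√t - 1), Real.sq_sqrt ht.le]
      have h3 := mul_le_mul_of_nonneg_right h2 (ricianWeight_pos γ t).le
      linarith
    have h2 := mul_le_mul_of_nonneg_left h1 hγ0.le
    have h3 : γ * (1 / 2 * (1 / γ + (1 + γ) / γ ^ 2)) = 1 + 1 / (2 * γ) := by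
      field_simp
      ring
    have h4 : 1 / (2 * γ) ≤ 2 / 3 := by
      rw [div_le_div_iff₀ (by positivity) (by norm_num)]
      linarith
    linarith

/-! ### Comparison of g with ĝ and the relative error -/

theorem continuous_gIntegrand (γ : ℝ) : Continuous (gIntegrand γ) := by
  unfold gIntegrand besselRatio
  have := continuous_besselI_zero
  have := continuous_besselI_one
  have h : ∀ x, besselI 0 x ≠ 0 := fun x => (besselI_zero_pos x).ne'
  fun_prop (disch := exact fun x => h _)

theorem gIntegrand_eq (γ t : ℝ) :
    gIntegrand γ t = γ * (t * ricianWeight γ t) * (1 - besselRatio (2 * γ * √t) ^ 2) := by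
  unfold gIntegrand ricianWeight
  ring

theorem integrableOn_gIntegrand {γ : ℝ} (hγ : 0 < γ) :
    IntegrableOn (gIntegrand γ) (Set.Ioi 0) := by
  refine Integrable.mono' ((integrableOn_mul_ricianWeight hγ).const_mul γ)
    (continuous_gIntegrand γ).aestronglyMeasurable ?_
  refine (ae_restrict_mem measurableSet_Ioi).mono fun t ht => ?_
  have ht : 0 < t := ht
  have h1 := besselRatio_sq_le_one (show 0 ≤ 2 * γ * √t by positivity)
  have h2 : 0 ≤ γ * (t * ricianWeight γ t) := by
    have := ricianWeight_pos γ t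
    positivity
  rw [gIntegrand_eq, Real.norm_of_nonneg (mul_nonneg h2 (by linarith))]
  exact mul_le_of_le_one_right h2 (by nlinarith [sq_nonneg (besselRatio (2 * γ * √t))])

theorem abs_half_sqrt_sub_gIntegrand_le {γ t : ℝ} (hγ : 0 < γ) (ht : 0 < t) :
    |1 / 2 * (√t * ricianWeight γ t) - gIntegrand γ t| ≤ 7 / 100 / γ * ricianWeight γ t := by
  have hz : 0 ≤ 2 * γ * √t := by positivity
  have h := abs_sub_sq_mul_besselRatio_le hz
  have hw := ricianWeight_pos γ t
  have e : 1 / 2 * (√t * ricianWeight γ t) - gIntegrand γ t =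
      (1 / (4 * γ) * ricianWeight γ t) * (2 * γ * √t - (2 * γ * √t) ^ 2 *
        (1 - besselRatio (2 * γ * √t) ^ 2)) := by
    rw [gIntegrand_eq, mul_pow (2 * γ), Real.sq_sqrt ht.le]
    field_simp
    ring
  rw [e, abs_mul, abs_of_pos (by positivity)]
  calc _ ≤ 1 / (4 * γ) * ricianWeight γ t * (7 / 25) := by gcongr
    _ = _ := by field_simp; norm_num

theorem abs_gHat_sub_g_le {γ : ℝ} (hγ : 0 < γ) : |gHat γ - g γ| ≤ 7 / 100 / γ ^ 2 := by
  have h1 : gHat γ - g γ = ∫ t in Set.Ioi (0 : ℝ),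
      (1 / 2 * (√t * ricianWeight γ t) - gIntegrand γ t) := by
    rw [integral_sub ((integrableOn_sqrt_mul_ricianWeight hγ).const_mul _)
      (integrableOn_gIntegrand hγ), integral_const_mul,
      integral_sqrt_mul_ricianWeight_eq_gHat hγ, g]
    ring
  have h2 : 7 / 100 / γ ^ 2 = ∫ t in Set.Ioi (0 : ℝ), 7 / 100 / γ * ricianWeight γ t := by
    rw [integral_const_mul, integral_ricianWeight hγ]
    field_simp
  rw [h1, h2, ← Real.norm_eq_abs]
  refine norm_integral_le_of_norm_le ((integrableOn_ricianWeight hγ).const_mul _) ?_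
  refine (ae_restrict_mem measurableSet_Ioi).mono fun t ht => ?_
  exact abs_half_sqrt_sub_gIntegrand_le hγ ht

theorem le_one_div_sub_g {γ : ℝ} (hγ : 0.42 < γ) :
    (γ / 6 - 0.07) / γ ^ 2 ≤ 1 / γ - g γ := by
  have hγ0 : 0 < γ := by norm_num at hγ; linarith
  have h1 := abs_le.1 (abs_gHat_sub_g_le hγ0)
  have h2 : gHat γ ≤ 5 / 6 / γ := by
    rw [le_div_iff₀ hγ0, mul_comm]
    exact mul_gHat_le hγ.le
  have e : (γ / 6 - 0.07) / γ ^ 2 = 1 / γ - 5 / 6 / γ - 7 / 100 / γ ^ 2 := by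
    field_simp
    norm_num
    ring
  rw [e]
  linarith [h1.1]

theorem one_div_sub_g_pos {γ : ℝ} (hγ : 0.42 < γ) : 0 < 1 / γ - g γ := by
  refine lt_of_lt_of_le ?_ (le_one_div_sub_g hγ)
  norm_num at hγ ⊢
  exact div_pos (by linarith) (by nlinarith)

theorem relError_le {γ : ℝ} (hγ : 0.42 < γ) : relError γ ≤ 0.07 / (γ / 6 - 0.07) := by
  have hγ0 : 0 < γ := by norm_num at hγ; linarith
  have h3 : 0 < γ / 6 - 0.07 := by norm_num at hγ ⊢; linarith
  have h : relError γ ≤ (7 / 100 / γ ^ 2) / ((γ / 6 - 0.07) / γ ^ 2) :=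
    div_le_div₀ (by positivity) (abs_gHat_sub_g_le hγ0) (by positivity) (le_one_div_sub_g hγ)
  refine h.trans (le_of_eq ?_)
  rw [div_div_div_cancel_right₀ (by positivity)]
  norm_num

theorem relError_isBigO : relError =O[atTop] fun γ : ℝ => 1 / γ := by
  -- For γ ≥ 1 the explicit bound is already at most 1/γ, because 0.07γ + 0.07 ≤ γ/6.
  refine IsBigO.of_bound 1 ?_
  filter_upwards [eventually_ge_atTop (1 : ℝ)] with γ hγ
  have h42 : (0.42 : ℝ) < γ := by norm_num; linarith
  have h0 : 0 ≤ relError γ := div_nonneg (abs_nonneg _) (one_div_sub_g_pos h42).le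
  rw [Real.norm_of_nonneg h0, Real.norm_of_nonneg (by positivity), one_mul]
  refine (relError_le h42).trans ?_
  rw [div_le_div_iff₀ (by norm_num; linarith) (by linarith)]
  norm_num
  linarith

end

end SensingRIS

theorem theorem3 :
    (SensingRIS.relError =O[atTop] fun γ : ℝ => 1 / γ) ∧
    ∀ γ : ℝ, 0.42 < γ →
      IntegrableOn (SensingRIS.gIntegrand γ) (Set.Ioi 0) ∧
      0 < 1 / γ - SensingRIS.g γ ∧
      SensingRIS.relError γ ≤ 0.07 / (γ / 6 - 0.07) :=
  ⟨SensingRIS.relError_isBigO, fun γ hγ =>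
    ⟨SensingRIS.integrableOn_gIntegrand (lt_trans (by norm_num) hγ),
      SensingRIS.one_div_sub_g_pos hγ, SensingRIS.relError_le hγ⟩⟩
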